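/- Let $K$ be a field and $d\in K$. The Temperley–Lieb category over $K$ with loop parameter $d$ has as objects the natural numbers $0,1,2,\dots$; $\mathrm{Hom}(m,n)$ is the $K$-vector space with basis the $(m,n)$-Temperley–Lieb diagrams, i.e. the non-crossing perfect pairings of $m$ points on the top edge and $n$ points on the bottom edge of a rectangle (so $\mathrm{Hom}(m,n)=0$ if $m+n$ is odd). The composition $ba$ of diagrams, for $a\in\mathrm{Hom}(\ell,m)$ and $b\in\mathrm{Hom}(m,n)$, is $d^{\,r}c$, where $c$ is obtained by placing $a$ on top of $b$ and removing all closed loops, and $r$ is the number of loops removed; the tensor product of diagrams is horizontal juxtaposition, with $m\otimes m'=m+m'$ on objects; both are extended bilinearly. An ideal is a family of subspaces $J(m,n)\subseteq\mathrm{Hom}(m,n)$, $m,n\ge 0$ (equivalently, a graded subspace of $\bigoplus_{m,n}\mathrm{Hom}(m,n)$), that is closed under composition (on either side, whenever defined) and under tensor product (on either side) with arbitrary morphisms. It is non-zero if some $J(m,n)\neq 0$, and proper if some $J(m,n)\neq\mathrm{Hom}(m,n)$. Let $\mathrm{TL}$ be the Temperley–Lieb category over $\mathbb C(t)$ with $d=t+t^{-1}$,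 and for $\tau\in\mathbb C$, $\tau\neq 0$, let $\mathrm{TL}(\tau)$ be the one over $\mathbb C$ with $d=\tau+\tau^{-1}$. Call $\tau$ a proper root of unity if $\tau$ is a root of unity and $\tau\neq\pm1$. **Corollary.** The category $\mathrm{TL}$ has no non-zero proper ideal. For every non-zero $\tau\in\mathbb C$ that is not a proper root of unity, the category $\mathrm{TL}(\tau)$ has no non-zero proper ideal. -/

import Mathlib

namespace TemperleyLieb

/-! ### Temperley-Lieb diagrams -/

/-- The marked points of a rectangle with `m` points on the top edge (`Sum.inl`) and `n` points on
the bottom edge (`Sum.inr`), both numbered from left to right. `pos` is the position of a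
marked point when one walks once around the boundary, along the top edge from left to right and
then back along the bottom edge from right to left. -/
def pos {m n : ℕ} : Fin m ⊕ Fin n → ℕ
  | Sum.inl i => i
  | Sum.inr j => m + j.rev

/-- An `(m,n)`-Temperley-Lieb diagram, up to equivalence: a perfect pairing of the `m + n` marked
points of the rectangle that can be drawn by pairwise disjoint curves inside the rectangle, that
is, no two of whose pairs separate each other on the boundary. The pairing is given by the map
`mate`, sending each point to the other end of its strand. -/
@[ext]
structure Diagram (m n : ℕ) where
  mate : Fin m ⊕ Fin n → Fin m ⊕ Fin n
  mate_mate : ∀ x, mate (mate x) = x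
  mate_ne : ∀ x, mate x ≠ x
  noncrossing : ∀ x y,
    ¬ (pos x < pos y ∧ pos y < pos (mate x) ∧ pos (mate x) < pos (mate y))

theorem pos_injective {m n : ℕ} : Function.Injective (pos : Fin m ⊕ Fin n → ℕ) := by
  rintro (i | i) (j | j) h <;> simp only [pos, Fin.val_rev] at h
  · exact congrArg _ (Fin.ext h)
  · omega
  · omega
  · exact congrArg _ (Fin.ext (by omega))

/-! ### Juxtaposition of two diagrams

The rectangle of `a` is put on top of the rectangle of `b`. The points of the juxtaposition are
`Sum.inl i` (top edge of `a`), `Sum.inr (Sum.inl j)` (the common edge) and `Sum.inr (Sum.inr k)`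
(bottom edge of `b`). -/

section Juxtapose

variable {l m n : ℕ}

/-- The points of the upper rectangle inside the juxtaposition. -/
def upperPt : Fin l ⊕ Fin m → Fin l ⊕ (Fin m ⊕ Fin n)
  | Sum.inl i => Sum.inl i
  | Sum.inr j => Sum.inr (Sum.inl j)

/-- The points of the outer boundary of the juxtaposition. -/
def outerPt : Fin l ⊕ Fin n → Fin l ⊕ (Fin m ⊕ Fin n)
  | Sum.inl i => Sum.inl i
  | Sum.inr k => Sum.inr (Sum.inr k)

/-- Follow the strand of the upper diagram `a` that ends at the given point (if there is one). -/
def upperStep (a : Diagram l m) : Fin l ⊕ (Fin m ⊕ Fin n) → Fin l ⊕ (Fin m ⊕ Fin n)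
  | Sum.inl i => upperPt (a.mate (Sum.inl i))
  | Sum.inr (Sum.inl j) => upperPt (a.mate (Sum.inr j))
  | Sum.inr (Sum.inr k) => Sum.inr (Sum.inr k)

/-- Follow the strand of the lower diagram `b` that ends at the given point (if there is one). -/
def lowerStep (b : Diagram m n) : Fin l ⊕ (Fin m ⊕ Fin n) → Fin l ⊕ (Fin m ⊕ Fin n)
  | Sum.inl i => Sum.inl i
  | Sum.inr y => Sum.inr (b.mate y)

/-- The graph on the points of the juxtaposition whose edges are the strands of `a` and of `b`.
Its connected components are the curves of the juxtaposition: closed loops in the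
interior, and curves that end at two points of the outer boundary. -/
def juxtapose (a : Diagram l m) (b : Diagram m n) :
    SimpleGraph (Fin l ⊕ (Fin m ⊕ Fin n)) :=
  SimpleGraph.fromRel (fun x y => y = upperStep a x ∨ y = lowerStep b x)

/-- The number of closed loops in the interior of the juxtaposition: the number of connected
components that contain no point of the outer boundary. -/
noncomputable def loops (a : Diagram l m) (b : Diagram m n) : ℕ :=
  Nat.card {c : (juxtapose a b).ConnectedComponent //
    ∀ x : Fin l ⊕ Fin n, outerPt x ∉ c.supp}

theorem upperStep_upperPt (a : Diagram l m) (x : Fin l ⊕ Fin m) :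
    upperStep a (upperPt x : Fin l ⊕ (Fin m ⊕ Fin n)) = upperPt (a.mate x) := by
  cases x <;> rfl

theorem upperPt_injective :
    Function.Injective (upperPt : Fin l ⊕ Fin m → Fin l ⊕ (Fin m ⊕ Fin n)) := by
  rintro (i | i) (j | j) h <;> simp_all [upperPt]

theorem outerPt_injective :
    Function.Injective (outerPt : Fin l ⊕ Fin n → Fin l ⊕ (Fin m ⊕ Fin n)) := by
  rintro (i | i) (j | j) h <;> simp_all [outerPt]

theorem upperStep_involutive (a : Diagram l m) :
    Function.Involutive (upperStep a : Fin l ⊕ (Fin m ⊕ Fin n) → _) := by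
  rintro (i | j | k)
  · change upperStep a (upperPt (a.mate (Sum.inl i))) = _
    rw [upperStep_upperPt, a.mate_mate]; rfl
  · change upperStep a (upperPt (a.mate (Sum.inr j))) = _
    rw [upperStep_upperPt, a.mate_mate]; rfl
  · rfl

theorem lowerStep_involutive (b : Diagram m n) :
    Function.Involutive (lowerStep b : Fin l ⊕ (Fin m ⊕ Fin n) → _) := by
  rintro (i | y)
  · rfl
  · simp [lowerStep, b.mate_mate]

theorem upperStep_upperPt_ne (a : Diagram l m) (x : Fin l ⊕ Fin m) :
    upperStep a (upperPt x : Fin l ⊕ (Fin m ⊕ Fin n)) ≠ upperPt x := by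
  rw [upperStep_upperPt]
  exact fun h => a.mate_ne x (upperPt_injective h)

/-- Along two involutions without common fixed point, the component of a fixed point contains
exactly one further fixed point. -/
theorem existsUnique_other_end {X : Type*} [Finite X] (σ τ : Equiv.Perm X)
    (hσ : ∀ x, σ (σ x) = x) (hτ : ∀ x, τ (τ x) = x) (hne : ∀ x, σ x = x → τ x ≠ x)
    (R : X → X → Prop) (hR : ∀ x y, R x y ↔ Relation.ReflTransGen
      (fun u v => v = σ u ∨ v = τ u) x y)
    (x : X) (hx : τ x = x) :
    ∃! y, y ≠ x ∧ R x y ∧ (σ y = y ∨ τ y = y) := by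
  set π : Equiv.Perm X := τ * σ with hπ
  have hτπ : ∀ k : ℤ, τ ((π ^ k) x) = (π ^ (-k)) x := by
    intro k
    have ti : τ⁻¹ = τ := inv_eq_of_mul_eq_one_left (Equiv.ext hτ)
    have si : σ⁻¹ = σ := inv_eq_of_mul_eq_one_left (Equiv.ext hσ)
    have h1 : τ * π ^ k * τ⁻¹ = π ^ (-k) := by
      rw [← conj_zpow, zpow_neg, ← inv_zpow]
      congr 1
      have : τ * τ = 1 := Equiv.ext hτ
      rw [hπ, mul_inv_rev, si, ti, ← mul_assoc, this, one_mul]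
    rw [← h1, ti, Equiv.Perm.mul_apply, Equiv.Perm.mul_apply, hx]
  have hσπ : ∀ k : ℤ, σ ((π ^ k) x) = (π ^ (-k - 1)) x := by
    intro k
    have : σ ((π ^ k) x) = τ ((π ^ (k + 1)) x) := by
      rw [add_comm, zpow_add, zpow_one]
      simp [hπ, hτ]
    rw [this, hτπ]
    congr 2; ring
  have hreach : ∀ y, R x y ↔ ∃ k : ℤ, y = (π ^ k) x := by
    intro y
    rw [hR]
    constructor
    · intro h
      induction h with
      | refl => exact ⟨0, by simp⟩
      | tail _ h ih =>
        obtain ⟨k, rfl⟩ := ih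
        rcases h with rfl | rfl
        · exact ⟨_, hσπ k⟩
        · exact ⟨_, hτπ k⟩
    · rintro ⟨k, rfl⟩
      have key : ∀ j : ℕ, Relation.ReflTransGen (fun u v => v = σ u ∨ v = τ u) x
          ((π ^ (j : ℤ)) x) := by
        intro j
        induction j with
        | zero => simpa using Relation.ReflTransGen.refl
        | succ j ih =>
          refine (ih.tail (Or.inl rfl)).tail (Or.inr ?_)
          push_cast
          rw [add_comm, zpow_add, zpow_one]
          simp [hπ]
      rcases Int.eq_nat_or_neg k with ⟨j, rfl | rfl⟩
      · exact key j
      · exact (key j).tail (Or.inr (hτπ j).symm)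
  set N := MulAction.period π x with hN
  have hdvd : ∀ j : ℤ, (π ^ j) x = x ↔ (N : ℤ) ∣ j := fun j =>
    MulAction.zpow_smul_eq_iff_period_dvd (g := π) (a := x)
  have hdvd2 : ∀ i j : ℤ, (π ^ i) x = (π ^ j) x ↔ (N : ℤ) ∣ j - i := by
    intro i j
    rw [← hdvd, sub_eq_neg_add, zpow_add, Equiv.Perm.mul_apply, zpow_neg,
      Equiv.Perm.inv_eq_iff_eq, eq_comm]
  have hNpos : 0 < N := by
    cases nonempty_fintype X
    classical
    exact MulAction.period_pos_of_orderOf_pos (orderOf_pos π) x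
  have hN1 : N ≠ 1 := by
    intro h
    have h1 : (π ^ (1 : ℤ)) x = x := by rw [hdvd, h]; simp
    have h2 := hσπ 0
    have h3 : (π ^ (-0 - 1 : ℤ)) x = x := by rw [hdvd, h]; simp
    rw [h3] at h2
    exact hne x (by simpa using h2) hx
  have hend : ∀ k : ℤ, (σ ((π ^ k) x) = (π ^ k) x ∨ τ ((π ^ k) x) = (π ^ k) x) ↔
      ((N : ℤ) ∣ 2 * k + 1 ∨ (N : ℤ) ∣ 2 * k) := by
    intro k
    rw [hσπ, hτπ, hdvd2, hdvd2]
    have e1 : k - (-k - 1) = 2 * k + 1 := by ring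
    have e2 : k - -k = 2 * k := by ring
    rw [e1, e2]
  have hM : ∀ k : ℤ, 0 ≤ k → k < N → (¬ (N : ℤ) ∣ k ∧
      ((N : ℤ) ∣ 2 * k + 1 ∨ (N : ℤ) ∣ 2 * k) ↔ k = N / 2) := by
    intro k h0 hk
    constructor
    · rintro ⟨h1, ⟨c, hc⟩ | ⟨c, hc⟩⟩
      · have : c < 2 := by nlinarith
        have : 0 < c := by nlinarith
        have : c = 1 := by omega
        subst this; omega
      · have : c < 2 := by nlinarith
        have : c ≠ 0 := by
          rintro rfl
          apply h1
          have : k = 0 := by omega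
          simp [this]
        have : 0 ≤ c := by nlinarith
        have : c = 1 := by omega
        subst this; omega
    · rintro rfl
      refine ⟨fun h => ?_, ?_⟩
      · have := Int.le_of_dvd (by omega) h
        omega
      · rcases Nat.even_or_odd' N with ⟨M, h | h⟩
        · right; refine ⟨1, ?_⟩; omega
        · left; refine ⟨1, ?_⟩; omega
  refine ⟨(π ^ ((N : ℤ) / 2)) x, ⟨?_, ?_, ?_⟩, ?_⟩
  · intro h
    exact (((hM (N / 2) (by omega) (by omega)).2 rfl).1) ((hdvd _).1 h)
  · exact (hreach _).2 ⟨_, rfl⟩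
  · exact (hend _).2 ((hM (N / 2) (by omega) (by omega)).2 rfl).2
  · rintro y ⟨hyx, hy, hy'⟩
    obtain ⟨k, rfl⟩ := (hreach y).1 hy
    have hk : (π ^ k) x = (π ^ (k % N)) x := by
      rw [hdvd2, Int.emod_def]
      exact ⟨-(k / N), by ring⟩
    rw [hk] at hy' hyx ⊢
    have := (hM (k % N) (Int.emod_nonneg _ (by omega)) (Int.emod_lt_of_pos _ (by omega))).1
      ⟨fun h => hyx ((hdvd _).2 h), (hend _).1 hy'⟩
    rw [this]

theorem juxtapose_reachable_iff (a : Diagram l m) (b : Diagram m n)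
    (x y : Fin l ⊕ (Fin m ⊕ Fin n)) : (juxtapose a b).Reachable x y ↔
      Relation.ReflTransGen (fun u v => v = upperStep a u ∨ v = lowerStep b u) x y := by
  rw [SimpleGraph.reachable_iff_reflTransGen]
  constructor
  · refine Relation.ReflTransGen.mono ?_ x y
    intro u v huv
    simp only [juxtapose, SimpleGraph.fromRel_adj] at huv
    obtain ⟨_, (h | h) | (h | h)⟩ := huv
    · exact Or.inl h
    · exact Or.inr h
    · exact Or.inl (by rw [h, upperStep_involutive a])
    · exact Or.inr (by rw [h, lowerStep_involutive b])
  · intro h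
    induction h with
    | refl => exact .refl
    | @tail u v _ h ih =>
      by_cases huv : u = v
      · exact huv ▸ ih
      · exact ih.tail (by simp only [juxtapose, SimpleGraph.fromRel_adj]; exact ⟨huv, Or.inl h⟩)

theorem isOuter_iff (a : Diagram l m) (b : Diagram m n) (y : Fin l ⊕ (Fin m ⊕ Fin n)) :
    (upperStep a y = y ∨ lowerStep b y = y) ↔ ∃ z : Fin l ⊕ Fin n, y = outerPt z := by
  rcases y with i | j | k
  · exact ⟨fun _ => ⟨Sum.inl i, rfl⟩, fun _ => Or.inr rfl⟩
  · constructor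
    · rintro (h | h)
      · exact absurd h (upperStep_upperPt_ne a (Sum.inr j))
      · exact absurd (Sum.inr_injective h) (b.mate_ne _)
    · rintro ⟨z | z, hz⟩ <;> simp [outerPt] at hz
  · exact ⟨fun _ => ⟨Sum.inr k, rfl⟩, fun _ => Or.inl rfl⟩

/-- A curve of the juxtaposition that ends at a point of the outer boundary ends at exactly one
further point of the outer boundary. -/
theorem existsUnique_mate (a : Diagram l m) (b : Diagram m n) (x : Fin l ⊕ Fin n) :
    ∃! y : Fin l ⊕ Fin n, y ≠ x ∧ (juxtapose a b).Reachable (outerPt x) (outerPt y) := by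
  have main : ∃! y, y ≠ outerPt x ∧ (juxtapose a b).Reachable (outerPt x) y ∧
      (upperStep a y = y ∨ lowerStep b y = y) := by
    have hA : ∀ y : Fin l ⊕ (Fin m ⊕ Fin n), upperStep a y = y → lowerStep b y ≠ y := by
      rintro (i | j | k) h h'
      · exact upperStep_upperPt_ne a (Sum.inl i) h
      · exact b.mate_ne _ (Sum.inr_injective h')
      · exact b.mate_ne _ (Sum.inr_injective h')
    rcases x with i | k
    · exact existsUnique_other_end (upperStep_involutive a).toPerm (lowerStep_involutive b).toPerm
        (upperStep_involutive a) (lowerStep_involutive b) hA (juxtapose a b).Reachable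
        (juxtapose_reachable_iff a b) (outerPt (Sum.inl i)) rfl
    · have := existsUnique_other_end (lowerStep_involutive b).toPerm
        (upperStep_involutive a).toPerm
        (lowerStep_involutive b) (upperStep_involutive a) (fun y h h' => hA y h' h)
        (juxtapose a b).Reachable
        (fun x y => by
          rw [juxtapose_reachable_iff]
          simp only [Function.Involutive.coe_toPerm, or_comm])
        (outerPt (Sum.inr k)) rfl
      simpa only [Function.Involutive.coe_toPerm, or_comm] using this
  obtain ⟨y, ⟨h1, h2, h3⟩, h4⟩ := main
  obtain ⟨z, rfl⟩ := (isOuter_iff a b y).1 h3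
  refine ⟨z, ⟨fun h => h1 (h ▸ rfl), h2⟩, ?_⟩
  rintro w ⟨hw, hw'⟩
  exact outerPt_injective (h4 (outerPt w)
    ⟨fun h => hw (outerPt_injective h), hw', (isOuter_iff a b _).2 ⟨w, rfl⟩⟩)

/-- The other end of the curve of the juxtaposition that ends at the outer boundary point `x`. -/
noncomputable def compMate (a : Diagram l m) (b : Diagram m n) (x : Fin l ⊕ Fin n) :
    Fin l ⊕ Fin n :=
  (existsUnique_mate a b x).choose

theorem compMate_ne (a : Diagram l m) (b : Diagram m n) (x : Fin l ⊕ Fin n) :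
    compMate a b x ≠ x :=
  (existsUnique_mate a b x).choose_spec.1.1

theorem reachable_compMate (a : Diagram l m) (b : Diagram m n) (x : Fin l ⊕ Fin n) :
    (juxtapose a b).Reachable (outerPt x) (outerPt (compMate a b x)) :=
  (existsUnique_mate a b x).choose_spec.1.2

theorem eq_compMate (a : Diagram l m) (b : Diagram m n) {x y : Fin l ⊕ Fin n} (h : y ≠ x)
    (h' : (juxtapose a b).Reachable (outerPt x) (outerPt y)) : y = compMate a b x :=
  (existsUnique_mate a b x).choose_spec.2 y ⟨h, h'⟩

theorem compMate_compMate (a : Diagram l m) (b : Diagram m n) (x : Fin l ⊕ Fin n) :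
    compMate a b (compMate a b x) = x :=
  (eq_compMate a b (compMate_ne a b x).symm (reachable_compMate a b x).symm).symm

/-- A function that is constant on strands has an even sum. -/
theorem sum_mate_eq_zero {m n : ℕ} (D : Diagram m n) (s : Fin m ⊕ Fin n → ZMod 2)
    (hs : ∀ x, s (D.mate x) = s x) : ∑ x, s x = 0 :=
  Finset.sum_involution (fun x _ => D.mate x)
    (fun x _ => by rw [hs]; exact CharTwo.add_self_eq_zero _)
    (fun x _ _ => D.mate_ne x) (fun _ _ => Finset.mem_univ _) (fun x _ => D.mate_mate x)

theorem cross_even {p p' q q' : ℕ} (h1 : p ≠ q) (h2 : p ≠ q') (h3 : p' ≠ q) (h4 : p' ≠ q')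
    (c1 : ¬ (p < q ∧ q < p' ∧ p' < q')) (c2 : ¬ (p < q' ∧ q' < p' ∧ p' < q))
    (c3 : ¬ (p' < q ∧ q < p ∧ p < q')) (c4 : ¬ (p' < q' ∧ q' < p ∧ p < q))
    (d1 : ¬ (q < p ∧ p < q' ∧ q' < p')) (d2 : ¬ (q' < p ∧ p < q ∧ q < p'))
    (d3 : ¬ (q < p' ∧ p' < q' ∧ q' < p)) (d4 : ¬ (q' < p' ∧ p' < q ∧ q < p)) :
    (if p < q then 1 else 0) + (if p < q' then 1 else 0) +
      ((if p' < q then 1 else 0) + (if p' < q' then 1 else 0)) = (0 : ZMod 2) := by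
  rcases lt_or_gt_of_ne h1 with h1 | h1 <;> rcases lt_or_gt_of_ne h2 with h2 | h2 <;>
  rcases lt_or_gt_of_ne h3 with h3 | h3 <;> rcases lt_or_gt_of_ne h4 with h4 | h4 <;>
  first
    | exact absurd ⟨by assumption, by assumption, by assumption⟩ c1
    | exact absurd ⟨by assumption, by assumption, by assumption⟩ c2
    | exact absurd ⟨by assumption, by assumption, by assumption⟩ c3
    | exact absurd ⟨by assumption, by assumption, by assumption⟩ c4
    | exact absurd ⟨by assumption, by assumption, by assumption⟩ d1
    | exact absurd ⟨by assumption, by assumption, by assumption⟩ d2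
    | exact absurd ⟨by assumption, by assumption, by assumption⟩ d3
    | exact absurd ⟨by assumption, by assumption, by assumption⟩ d4
    | (simp only [h1, h2, h3, h4, h1.not_gt, h2.not_gt, h3.not_gt, h4.not_gt, if_true, if_false]
       decide)

/-- The number of crossings of two disjoint families of strands of a diagram, modulo `2`. -/
theorem sum_cross_eq_zero {m n : ℕ} (D : Diagram m n) (s t : Fin m ⊕ Fin n → ZMod 2)
    (hs : ∀ x, s (D.mate x) = s x) (ht : ∀ x, t (D.mate x) = t x) (hst : ∀ x, s x * t x = 0) :
    ∑ x, ∑ y, s x * t y * (if pos x < pos y then 1 else 0) = 0 := by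
  refine Finset.sum_involution (fun x _ => D.mate x) ?_
    (fun x _ _ => D.mate_ne x) (fun _ _ => Finset.mem_univ _) (fun x _ => D.mate_mate x)
  intro x _
  rw [← Finset.sum_add_distrib]
  refine Finset.sum_involution (fun y _ => D.mate y) ?_
    (fun y _ _ => D.mate_ne y) (fun _ _ => Finset.mem_univ _) (fun y _ => D.mate_mate y)
  intro y _
  rw [hs, ht]
  by_cases hxy : s x * t y = 0
  · simp [hxy]
  have h1 : pos x ≠ pos y := fun h => by
    rw [← pos_injective h] at hxy; exact hxy (hst x)
  have h2 : pos x ≠ pos (D.mate y) := fun h => by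
    apply hxy
    rw [pos_injective h, hs]; exact hst y
  have h3 : pos (D.mate x) ≠ pos y := fun h => by
    apply hxy
    rw [← pos_injective h, ht]; exact hst x
  have h4 : pos (D.mate x) ≠ pos (D.mate y) := fun h => by
    apply hxy
    rw [← ht y, ← pos_injective h, ht]; exact hst x
  rw [← mul_add, ← mul_add, ← mul_add]
  refine mul_eq_zero_of_right _ ?_
  have c2 := D.noncrossing x (D.mate y)
  have c3 := D.noncrossing (D.mate x) y
  have c4 := D.noncrossing (D.mate x) (D.mate y)
  have d2 := D.noncrossing (D.mate y) x
  have d3 := D.noncrossing y (D.mate x)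
  have d4 := D.noncrossing (D.mate y) (D.mate x)
  rw [D.mate_mate] at c2 c3 d2 d3
  rw [D.mate_mate, D.mate_mate] at c4 d4
  rw [add_add_add_comm]
  exact cross_even h1 h2 h3 h4 (D.noncrossing x y) c2 c3 c4 (D.noncrossing y x) d2 d3 d4

theorem sum_sum_mul {α β : Type*} [Fintype α] [Fintype β] (f : α → ZMod 2) (g : β → ZMod 2) :
    ∑ x, ∑ y, f x * g y = (∑ x, f x) * ∑ y, g y :=
  (Finset.sum_mul_sum _ _ _ _).symm

/-- Expansion of the crossing number along the two edges. -/
theorem sum_cross_expand {m n : ℕ} (s t : Fin m ⊕ Fin n → ZMod 2) :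
    ∑ x, ∑ y, s x * t y * (if pos x < pos y then 1 else 0) =
      (∑ i, ∑ j, s (Sum.inl i) * t (Sum.inl j) * (if i < j then 1 else 0)) +
      (∑ i, s (Sum.inl i)) * (∑ j, t (Sum.inr j)) +
      (∑ i, ∑ j, s (Sum.inr i) * t (Sum.inr j) * (if j < i then 1 else 0)) := by
  have e1 : ∀ (i : Fin m) (j : Fin n), pos (Sum.inl i : Fin m ⊕ Fin n) < pos (Sum.inr j : Fin m ⊕ Fin n) := by
    intro i j; simp only [pos]; omega
  have e2 : ∀ (i : Fin m) (j : Fin n), ¬ pos (Sum.inr j : Fin m ⊕ Fin n) < pos (Sum.inl i : Fin m ⊕ Fin n) := by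
    intro i j; simp only [pos]; omega
  have e3 : ∀ i j : Fin m, pos (Sum.inl i : Fin m ⊕ Fin n) < pos (Sum.inl j : Fin m ⊕ Fin n) ↔ i < j := by
    intro i j; simp only [pos]; omega
  have e4 : ∀ i j : Fin n, pos (Sum.inr i : Fin m ⊕ Fin n) < pos (Sum.inr j : Fin m ⊕ Fin n) ↔ j < i := by
    intro i j; simp only [pos, Fin.val_rev]; omega
  simp only [Fintype.sum_sum_type, e1, e2, e3, e4, if_true, if_false, mul_one, mul_zero,
    Finset.sum_const_zero, Finset.sum_add_distrib, sum_sum_mul, add_zero, add_assoc]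

theorem compMate_noncrossing (a : Diagram l m) (b : Diagram m n) (x y : Fin l ⊕ Fin n) :
    ¬ (pos x < pos y ∧ pos y < pos (compMate a b x) ∧
      pos (compMate a b x) < pos (compMate a b y)) := by
  classical
  rintro ⟨h1, h2, h3⟩
  set G := juxtapose a b
  have hxy : ¬ G.Reachable (outerPt x) (outerPt y) := by
    intro h
    have hne : y ≠ x := by rintro rfl; omega
    have := eq_compMate a b hne h
    rw [← this] at h2; omega
  have hstep : ∀ u, G.Reachable u (upperStep a u) ∧ G.Reachable u (lowerStep b u) := fun u =>
    ⟨(juxtapose_reachable_iff a b _ _).2 (.single (Or.inl rfl)),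
      (juxtapose_reachable_iff a b _ _).2 (.single (Or.inr rfl))⟩
  -- indicator functions of the two curves
  let s : Fin l ⊕ (Fin m ⊕ Fin n) → ZMod 2 := fun u => if G.Reachable (outerPt x) u then 1 else 0
  let t : Fin l ⊕ (Fin m ⊕ Fin n) → ZMod 2 := fun u => if G.Reachable (outerPt y) u then 1 else 0
  have inv : ∀ z u v, G.Reachable u v → (G.Reachable z v ↔ G.Reachable z u) := fun z u v h =>
    ⟨fun h' => h'.trans h.symm, fun h' => h'.trans h⟩
  have hst : ∀ u, s u * t u = 0 := by
    intro u
    simp only [s, t]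
    split_ifs with h h'
    · exact absurd (h.trans h'.symm) hxy
    all_goals simp
  have sU : ∀ z, s (upperPt (a.mate z)) = s (upperPt z) := fun z => by
    rw [← upperStep_upperPt]; simp only [s, inv _ _ _ (hstep _).1]
  have tU : ∀ z, t (upperPt (a.mate z)) = t (upperPt z) := fun z => by
    rw [← upperStep_upperPt]; simp only [t, inv _ _ _ (hstep _).1]
  have sL : ∀ z, s (Sum.inr (b.mate z)) = s (Sum.inr z) := fun z => by
    simp only [s]; exact if_congr (inv _ _ _ (hstep (Sum.inr z)).2) rfl rfl
  have tL : ∀ z, t (Sum.inr (b.mate z)) = t (Sum.inr z) := fun z => by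
    simp only [t]; exact if_congr (inv _ _ _ (hstep (Sum.inr z)).2) rfl rfl
  have U := sum_cross_eq_zero a (fun z => s (upperPt z)) (fun z => t (upperPt z)) sU tU
    (fun z => hst _)
  have L := sum_cross_eq_zero b (fun z => s (Sum.inr z)) (fun z => t (Sum.inr z)) sL tL
    (fun z => hst _)
  have pU := sum_mate_eq_zero a (fun z => s (upperPt z)) sU
  have qU := sum_mate_eq_zero a (fun z => t (upperPt z)) tU
  have pL := sum_mate_eq_zero b (fun z => s (Sum.inr z)) sL
  have qL := sum_mate_eq_zero b (fun z => t (Sum.inr z)) tL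
  rw [sum_cross_expand] at U L
  rw [Fintype.sum_sum_type] at pU qU pL qL
  simp only [upperPt] at U pU qU
  have mid : (∑ i : Fin m, ∑ j : Fin m, s (Sum.inr (Sum.inl i)) * t (Sum.inr (Sum.inl j)) *
        (if j < i then 1 else 0)) +
      (∑ i : Fin m, ∑ j : Fin m, s (Sum.inr (Sum.inl i)) * t (Sum.inr (Sum.inl j)) *
        (if i < j then 1 else 0)) =
      (∑ i : Fin m, s (Sum.inr (Sum.inl i))) * (∑ j : Fin m, t (Sum.inr (Sum.inl j))) := by
    rw [← sum_sum_mul, ← Finset.sum_add_distrib]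
    refine Finset.sum_congr rfl fun i _ => ?_
    rw [← Finset.sum_add_distrib]
    refine Finset.sum_congr rfl fun j _ => ?_
    rcases lt_trichotomy i j with h | rfl | h
    · simp [h, h.le]
    · simp [hst]
    · simp [h, h.le]
  have O : ∑ z : Fin l ⊕ Fin n, ∑ w : Fin l ⊕ Fin n, s (outerPt z) * t (outerPt w) *
      (if pos z < pos w then 1 else 0) = 0 := by
    rw [sum_cross_expand (fun z => s (outerPt z)) (fun z => t (outerPt z))]
    simp only [outerPt]
    have char : ∀ u v : ZMod 2, u + v = 0 → u = v := by decide
    have p1 := char _ _ pU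
    have p2 := char _ _ pL
    have q1 := char _ _ qU
    have q2 := char _ _ qL
    rw [← q2, p1]
    rw [p1] at U
    rw [← q2] at L
    have fin : ∀ A B C D P : ZMod 2, A + P + B = 0 → C + P + D = 0 → B + C = P →
        A + P + D = 0 := by decide
    exact fin _ _ _ _ _ U L mid
  have sO : ∀ z, s (outerPt z) = (if z = x then 1 else 0) + (if z = compMate a b x then 1 else 0) := by
    intro z
    by_cases hz : z = x
    · subst hz; simp [s, (compMate_ne a b z).symm]
    · by_cases hz' : z = compMate a b x
      · subst hz'; simp [s, hz, reachable_compMate, G]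
      · have : ¬ G.Reachable (outerPt x) (outerPt z) := fun h => hz' (eq_compMate a b hz h)
        simp [s, hz, hz', this]
  have tO : ∀ z, t (outerPt z) = (if z = y then 1 else 0) + (if z = compMate a b y then 1 else 0) := by
    intro z
    by_cases hz : z = y
    · subst hz; simp [t, (compMate_ne a b z).symm]
    · by_cases hz' : z = compMate a b y
      · subst hz'; simp [t, hz, reachable_compMate, G]
      · have : ¬ G.Reachable (outerPt y) (outerPt z) := fun h => hz' (eq_compMate a b hz h)
        simp [t, hz, hz', this]
  have pick : ∀ (u v : Fin l ⊕ Fin n) (F : Fin l ⊕ Fin n → Fin l ⊕ Fin n → ZMod 2),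
      ∑ z, ∑ w, (if z = u then 1 else 0) * (if w = v then 1 else 0) * F z w = F u v := by
    intro u v F
    rw [Finset.sum_eq_single u (fun z _ hz => by simp [hz]) (by simp),
      Finset.sum_eq_single v (fun z _ hz => by simp [hz]) (by simp)]
    simp
  simp only [sO, tO, add_mul, mul_add, Finset.sum_add_distrib, pick] at O
  simp only [h1, h3, h2.not_gt, (h1.trans h2).trans h3, if_true, if_false] at O
  revert O
  decide

/-- The diagram obtained from the juxtaposition by removing the closed loops. -/
noncomputable def Diagram.comp (b : Diagram m n) (a : Diagram l m) : Diagram l n where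
  mate := compMate a b
  mate_mate := compMate_compMate a b
  mate_ne := compMate_ne a b
  noncrossing := compMate_noncrossing a b

end Juxtapose

/-! ### Horizontal juxtaposition -/

/-- The marked points of the horizontal juxtaposition of two rectangles: on each of the two edges,
the points of the left rectangle come first, then those of the right rectangle. -/
def tensorPts (m n m' n' : ℕ) :
    Fin (m + m') ⊕ Fin (n + n') ≃ (Fin m ⊕ Fin n) ⊕ (Fin m' ⊕ Fin n') :=
  (Equiv.sumCongr finSumFinEquiv.symm finSumFinEquiv.symm).trans (Equiv.sumSumSumComm _ _ _ _)

theorem pos_tensorPts_symm_inl {m n m' n' : ℕ} (x : Fin m ⊕ Fin n) :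
    pos ((tensorPts m n m' n').symm (Sum.inl x)) =
      if pos x < m then pos x else pos x + (m' + n') := by
  rcases x with i | j
  · simp [tensorPts, pos]
  · simp [tensorPts, pos, Fin.val_rev]; omega

theorem pos_tensorPts_symm_inr {m n m' n' : ℕ} (x : Fin m' ⊕ Fin n') :
    pos ((tensorPts m n m' n').symm (Sum.inr x)) = m + pos x := by
  rcases x with i | j
  · simp [tensorPts, pos]
  · simp [tensorPts, pos, Fin.val_rev]; omega

theorem pos_lt {m n : ℕ} (x : Fin m ⊕ Fin n) : pos x < m + n := by
  rcases x with i | j <;> simp only [pos] <;> omega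

/-- The tensor product of diagrams: horizontal juxtaposition, the first one on the left. -/
def Diagram.tensor {m n m' n' : ℕ} (a : Diagram m n) (b : Diagram m' n') :
    Diagram (m + m') (n + n') where
  mate x := (tensorPts m n m' n').symm (Sum.map a.mate b.mate (tensorPts m n m' n' x))
  mate_mate x := by
    rw [Equiv.apply_symm_apply, Sum.map_map, Equiv.symm_apply_eq]
    rcases tensorPts m n m' n' x with y | y <;> simp [a.mate_mate, b.mate_mate]
  mate_ne x := by
    rw [Ne, Equiv.symm_apply_eq]
    rcases tensorPts m n m' n' x with y | y <;> simp [a.mate_ne, b.mate_ne]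
  noncrossing x y := by
    obtain ⟨x, rfl⟩ := (tensorPts m n m' n').symm.surjective x
    obtain ⟨y, rfl⟩ := (tensorPts m n m' n').symm.surjective y
    rw [Equiv.apply_symm_apply, Equiv.apply_symm_apply]
    rcases x with x | x <;> rcases y with y | y <;>
      simp only [Sum.map_inl, Sum.map_inr, pos_tensorPts_symm_inl, pos_tensorPts_symm_inr]
    · have := a.noncrossing x y
      split_ifs <;> omega
    · have := pos_lt y
      have := pos_lt (b.mate y)
      split_ifs <;> omega
    · have := pos_lt x
      have := pos_lt (b.mate x)
      split_ifs <;> omega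
    · have := b.noncrossing x y
      omega

/-! ### The Temperley-Lieb category over a field, with loop parameter `d` -/

/-- The space of morphisms from `m` to `n`: the vector space with basis the `(m,n)`-diagrams. -/
abbrev Hom (K : Type*) [Field K] (m n : ℕ) : Type _ := Diagram m n →₀ K

/-- Composition `g ∘ f`: the bilinear extension of `b ∘ a = d ^ r • c`, where `c` is the
juxtaposition of `a` (on top) and `b` without its closed loops and `r` is the number of closed
loops removed. -/
noncomputable def comp {K : Type*} [Field K] (d : K) {l m n : ℕ} (g : Hom K m n) (f : Hom K l m) :
    Hom K l n :=
  g.sum fun b y => f.sum fun a x => Finsupp.single (b.comp a) (y * x * d ^ loops a b)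

/-- Tensor product of morphisms: the bilinear extension of the tensor product of diagrams. -/
noncomputable def tensor {K : Type*} [Field K] {m n m' n' : ℕ} (f : Hom K m n) (g : Hom K m' n') :
    Hom K (m + m') (n + n') :=
  f.sum fun a x => g.sum fun b y => Finsupp.single (a.tensor b) (x * y)

/-- An ideal of the Temperley-Lieb category over `K` with loop parameter `d`: a (graded) subspace
of the direct sum of all `Hom K m n`, given by its components, that is closed under composition
and tensor product with arbitrary morphisms on either side. -/
structure TensorIdeal (K : Type*) [Field K] (d : K) where
  carrier : ∀ m n : ℕ, Submodule K (Hom K m n)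
  comp_left : ∀ {l m n : ℕ} (g : Hom K m n) (f : Hom K l m),
    f ∈ carrier l m → comp d g f ∈ carrier l n
  comp_right : ∀ {l m n : ℕ} (g : Hom K m n) (f : Hom K l m),
    g ∈ carrier m n → comp d g f ∈ carrier l n
  tensor_left : ∀ {m n m' n' : ℕ} (g : Hom K m n) (f : Hom K m' n'),
    f ∈ carrier m' n' → tensor g f ∈ carrier (m + m') (n + n')
  tensor_right : ∀ {m n m' n' : ℕ} (g : Hom K m n) (f : Hom K m' n'),
    g ∈ carrier m n → tensor g f ∈ carrier (m + m') (n + n')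

/-- The ideal contains a non-zero morphism. -/
def TensorIdeal.IsNonzero {K : Type*} [Field K] {d : K} (J : TensorIdeal K d) : Prop :=
  ∃ (m n : ℕ) (f : Hom K m n), f ∈ J.carrier m n ∧ f ≠ 0

/-- The ideal does not contain all morphisms. -/
def TensorIdeal.IsProper {K : Type*} [Field K] {d : K} (J : TensorIdeal K d) : Prop :=
  ∃ (m n : ℕ) (f : Hom K m n), f ∉ J.carrier m n

/-- A proper root of unity: a root of unity different from `1` and `-1`. -/
def IsProperRootOfUnity (τ : ℂ) : Prop :=
  (∃ k : ℕ, 0 < k ∧ τ ^ k = 1) ∧ τ ≠ 1 ∧ τ ≠ -1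

end TemperleyLieb

/-! If all quantum integers `[k + 1]` are non-zero, any non-zero ideal `J` can be pushed down to
`Hom 0 0`, which is the ground field. It then contains the unit of the tensor product, hence every
morphism (`TensorIdeal.not_isProper`).

Bending the bottom points of a morphism to the top is tensoring with an identity and composing with
nested caps. This stays inside `J`, creates no loops and is injective on diagrams
(`bend_injective`), so some `Hom n 0` meets `J` in a non-zero element.

To lower `n` by two, a cup must be found whose composite with a given non-zero `x` in `Hom (n + 2)
0` is non-zero. The generators `e i` act on this space, and `e i x` is determined by the composite
of `x` with the `i`-th cup (`comp_cup_ne_zero`), so it is enough that some `e i x` is non-zero.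
Non-vanishing quantum integers give a Jones-Wenzl element `p` (`exists_jonesWenzl`) with `p * e i =
0` and `1 - p` in the left ideal of the `e i`. Every diagram without bottom points joins two
neighbours, so it is a multiple of its image under some `e i`; hence `p` acts as zero. Thus `1` lies
in the left ideal, and an `x` killed by all `e i` is zero (`exists_generator_ne_zero`).

Finally, for `d = τ + τ⁻¹` in characteristic zero, a zero of `[k + 1]` forces `τ` to be a root of
unity other than `±1` (`quantumInt_ne_zero`). -/

namespace TemperleyLieb

/-! ### Quantum integers. -/

/-- The quantum integers `[n]` with `[2] = d`. -/
def quantumInt {K : Type*} [Field K] (d : K) : ℕ → K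
  | 0 => 0
  | 1 => 1
  | n + 2 => d * quantumInt d (n + 1) - quantumInt d n

/-- Both sides satisfy the same two-step recursion. The factor is not divided out because it
vanishes at `τ = ±1`. -/
theorem mul_quantumInt {K : Type*} [Field K] {τ : K} (hτ : τ ≠ 0) (n : ℕ) :
    (τ - τ⁻¹) * quantumInt (τ + τ⁻¹) n = τ ^ n - τ⁻¹ ^ n := by
  induction n using Nat.twoStepInduction with
  | zero => simp [quantumInt]
  | one => simp [quantumInt]
  | more n h1 h2 =>
    have h3 : (τ - τ⁻¹) * quantumInt (τ + τ⁻¹) (n + 2) =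
        (τ + τ⁻¹) * ((τ - τ⁻¹) * quantumInt (τ + τ⁻¹) (n + 1)) -
          (τ - τ⁻¹) * quantumInt (τ + τ⁻¹) n := by
      rw [quantumInt]; ring
    have h4 : τ * τ⁻¹ = 1 := mul_inv_cancel₀ hτ
    rw [h3, h1, h2]
    linear_combination (τ ^ n - τ⁻¹ ^ n) * h4

/-- Covers the degenerate case `τ = τ⁻¹`, where `mul_quantumInt` reads `0 = 0`. -/
theorem quantumInt_of_mul_self_eq_one {K : Type*} [Field K] {s : K} (hs : s * s = 1) (n : ℕ) :
    quantumInt (s + s) n = n * s ^ (n + 1) := by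
  induction n using Nat.twoStepInduction with
  | zero => simp [quantumInt]
  | one => simp [quantumInt, pow_succ, hs]
  | more n h1 h2 =>
    rw [quantumInt, h1, h2]
    push_cast
    linear_combination (n * s ^ (n + 1)) * hs

theorem quantumInt_ne_zero {K : Type*} [Field K] [CharZero K] {τ : K} (hτ : τ ≠ 0)
    (h : ∀ k : ℕ, 0 < k → τ ^ k = 1 → τ = 1 ∨ τ = -1) (n : ℕ) :
    quantumInt (τ + τ⁻¹) (n + 1) ≠ 0 := by
  intro h0
  have h1 := mul_quantumInt hτ (n + 1)
  rw [h0, mul_zero, eq_comm, sub_eq_zero, inv_pow] at h1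
  -- A vanishing `[n + 1]` gives `τ ^ (n + 1) = τ⁻¹ ^ (n + 1)`, so `τ` is a root of unity and by `h`
  -- equals `±1`. There the quantum integer is an ordinary integer up to sign.
  have h2 : τ ^ (n + 1 + (n + 1)) = 1 := by
    rw [pow_add]
    nth_rw 1 [h1]
    exact inv_mul_cancel₀ (pow_ne_zero _ hτ)
  have hs : τ * τ = 1 := by
    rcases h _ (by omega) h2 with rfl | rfl <;> simp
  have hi : τ⁻¹ = τ := inv_eq_of_mul_eq_one_left hs
  rw [hi, quantumInt_of_mul_self_eq_one hs] at h0
  exact mul_ne_zero (Nat.cast_ne_zero.2 n.succ_ne_zero) (pow_ne_zero _ hτ) h0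

/-! ### Jones-Wenzl projectors. -/

/-- The elements killing `x` from the left form a left ideal; it contains `S`, hence `1 - p`. -/
theorem one_sub_mul_eq_zero {A : Type*} [Ring A] {S : Set A} {p x : A}
    (hp : 1 - p ∈ Ideal.span S) (hx : ∀ s ∈ S, s * x = 0) : x = p * x := by
  have : ∀ y ∈ Ideal.span S, y * x = 0 := by
    intro y hy
    induction hy using Submodule.span_induction with
    | mem y hy => exact hx y hy
    | zero => simp
    | add y z _ _ hy hz => rw [add_mul, hy, hz, add_zero]
    | smul a y _ hy => rw [smul_eq_mul, mul_assoc, hy, mul_zero]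
  have h := this _ hp
  rwa [sub_mul, one_mul, sub_eq_zero] at h

/-- Existence of the Jones-Wenzl projector: in an algebra with elements `e i`, `i < L`, satisfying
the Temperley-Lieb relations, there is an element annihilated by all `e i` and congruent
to `1` modulo the left ideal generated by the `e i`. -/
theorem exists_jonesWenzl {K A : Type*} [Field K] [Ring A] [Algebra K A] {d : K}
    (hq : ∀ n, quantumInt d (n + 1) ≠ 0) {L : ℕ} {e : ℕ → A}
    (hsq : ∀ i < L, e i * e i = d • e i)
    (hup : ∀ i, i + 1 < L → e (i + 1) * e i * e (i + 1) = e (i + 1))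
    (hcomm : ∀ i j, i + 1 < j → j < L → Commute (e i) (e j)) :
    ∃ p : A, (∀ i < L, p * e i = 0) ∧ 1 - p ∈ Ideal.span (e '' Set.Iio L) := by
  -- Here `p` is the projector for the first `n` generators and `r` its predecessor. The last
  -- identity is an algebraic form of the partial trace formula for `p`; it drives Wenzl's recursion
  -- and needs `r` carried along.
  suffices H : ∀ n ≤ L, ∃ p r : A, (∀ i < n, p * e i = 0) ∧ (∀ i < n, e i * p = 0) ∧
      1 - p ∈ Ideal.span (e '' Set.Iio n) ∧ (∀ j, n < j → j < L → Commute p (e j)) ∧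
      (n < L → Commute r (e n) ∧ r * p = p ∧ p * r = p ∧
        e n * p * e n = (quantumInt d (n + 2) / quantumInt d (n + 1)) • (r * e n)) by
    obtain ⟨p, r, h1, -, h2, -⟩ := H L le_rfl
    exact ⟨p, h1, h2⟩
  intro n
  induction n with
  | zero =>
    intro _
    -- With no generators both projectors are `1`, and the trace identity is `e 0 * e 0 = d • e 0`,
    -- as `[2] / [1] = d`.
    refine ⟨1, 1, by simp, by simp, by simp, fun _ _ _ => Commute.one_left _, fun h => ?_⟩
    refine ⟨Commute.one_left _, by simp, by simp, ?_⟩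
    simp [quantumInt, hsq 0 h]
  | succ n ih =>
    intro hn
    obtain ⟨p, r, hpe, hep, hspan, hpc, hr⟩ := ih (by omega)
    obtain ⟨hre, hrp, hpr, hepe⟩ := hr (by omega)
    have hpp : p * p = p := by
      refine (one_sub_mul_eq_zero hspan ?_).symm
      rintro _ ⟨i, hi, rfl⟩
      exact hep i hi
    set c : K := quantumInt d (n + 1) / quantumInt d (n + 2) with hc
    have hcc : c * (quantumInt d (n + 2) / quantumInt d (n + 1)) = 1 := by
      have := hq n
      have := hq (n + 1)
      rw [hc]; field_simp
    -- This and `hR` say that subtracting `c • (p * e n * p)` from `p` makes it orthogonal to `e n`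
    -- on both sides.
    have hL : e n * p = c • (e n * p * e n * p) := by
      rw [hepe, smul_mul_assoc, smul_smul, hcc, one_smul, hre.eq, mul_assoc, hrp]
    have hR : p * e n = c • (p * e n * p * e n) := by
      have : p * e n * p * e n = p * (e n * p * e n) := by simp only [mul_assoc]
      rw [this, hepe, mul_smul_comm, smul_smul, hcc, one_smul, ← mul_assoc, hpr]
    -- Wenzl's recursion; the old projector becomes the new predecessor.
    refine ⟨p - c • (p * e n * p), p, ?_, ?_, ?_, ?_, ?_⟩
    · intro i hi
      rcases Nat.lt_succ_iff_lt_or_eq.1 hi with hi | rfl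
      · rw [sub_mul, smul_mul_assoc, mul_assoc _ p, hpe i hi]; simp
      · rw [sub_mul, smul_mul_assoc, ← hR, sub_self]
    · intro i hi
      rcases Nat.lt_succ_iff_lt_or_eq.1 hi with hi | rfl
      · rw [mul_sub, mul_smul_comm, ← mul_assoc, ← mul_assoc, hep i hi]; simp
      · rw [mul_sub, mul_smul_comm, ← mul_assoc, ← mul_assoc, ← hL, sub_self]
    · have hmono : Ideal.span (e '' Set.Iio n) ≤ Ideal.span (e '' Set.Iio (n + 1)) :=
        Ideal.span_mono (Set.image_mono (Set.Iio_subset_Iio (by omega)))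
      have hen : e n ∈ Ideal.span (e '' Set.Iio (n + 1)) :=
        Ideal.subset_span ⟨n, by simp, rfl⟩
      -- Rewritten so that each term is a left multiple of `1 - p` or of `e n`; the bare term `p * e
      -- n * p` is not visibly one.
      have : 1 - (p - c • (p * e n * p)) =
          (1 - p) + (algebraMap K A c * p) * e n - (algebraMap K A c * p * e n) * (1 - p) := by
        rw [Algebra.smul_def]; noncomm_ring
      rw [this]
      exact sub_mem (add_mem (hmono hspan) (Ideal.mul_mem_left _ _ hen))
        (Ideal.mul_mem_left _ _ (hmono hspan))
    · intro j hj hjL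
      have h1 := hpc j (by omega) hjL
      exact h1.sub_left (((h1.mul_left (hcomm n j hj hjL)).mul_left h1).smul_left c)
    · intro hL'
      have h1 := hpc (n + 1) (by omega) hL'
      refine ⟨h1, ?_, ?_, ?_⟩
      · rw [mul_sub, mul_smul_comm, ← mul_assoc, ← mul_assoc, hpp]
      · rw [sub_mul, smul_mul_assoc, mul_assoc _ p p, hpp]
      -- Since `p` commutes with `e (n + 1)`, both copies of `p` move outwards and the
      -- Temperley-Lieb relation applies between them.
      · have h2 : e (n + 1) * (p * e n * p) * e (n + 1) = p * e (n + 1) := by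
          calc e (n + 1) * (p * e n * p) * e (n + 1)
              = (e (n + 1) * p) * e n * (p * e (n + 1)) := by simp only [mul_assoc]
            _ = p * (e (n + 1) * e n * e (n + 1)) * p := by rw [← h1.eq]; simp only [mul_assoc]; rw [h1.eq]
            _ = p * e (n + 1) := by rw [hup n hL', mul_assoc, ← h1.eq, ← mul_assoc, hpp]
        have h3 : e (n + 1) * p * e (n + 1) = d • (p * e (n + 1)) := by
          rw [← h1.eq, mul_assoc, hsq _ hL', mul_smul_comm]
        rw [mul_sub, sub_mul, h3, mul_smul_comm, smul_mul_assoc, h2, ← sub_smul]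
        -- What remains is `d - [n + 1] / [n + 2] = [n + 3] / [n + 2]`, the defining recursion.
        congr 1
        have := hq (n + 1)
        rw [hc, quantumInt.eq_3 d (n + 1)]
        field_simp

/-! ### Diagrams without bottom points -/

/-- The strands of a diagram without bottom points, as a map on the top points. -/
def Diagram.arc {m : ℕ} (D : Diagram m 0) (i : Fin m) : Fin m :=
  Sum.elim id Fin.elim0 (D.mate (Sum.inl i))

theorem Diagram.mate_inl {m : ℕ} (D : Diagram m 0) (i : Fin m) :
    D.mate (Sum.inl i) = Sum.inl (D.arc i) := by
  unfold Diagram.arc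
  rcases D.mate (Sum.inl i) with j | k
  · rfl
  · exact k.elim0

theorem Diagram.arc_arc {m : ℕ} (D : Diagram m 0) (i : Fin m) : D.arc (D.arc i) = i := by
  apply Sum.inl_injective (β := Fin 0)
  rw [← D.mate_inl, ← D.mate_inl, D.mate_mate]

theorem Diagram.arc_ne {m : ℕ} (D : Diagram m 0) (i : Fin m) : D.arc i ≠ i := by
  intro h
  apply D.mate_ne (Sum.inl i)
  rw [D.mate_inl, h]

theorem Diagram.arc_noncrossing {m : ℕ} (D : Diagram m 0) (i j : Fin m) :
    ¬ (i < j ∧ j < D.arc i ∧ D.arc i < D.arc j) := by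
  have := D.noncrossing (Sum.inl i) (Sum.inl j)
  rw [D.mate_inl, D.mate_inl] at this
  exact this

theorem Diagram.arc_injective {m : ℕ} :
    Function.Injective (Diagram.arc : Diagram m 0 → Fin m → Fin m) := by
  intro D D' h
  ext1
  funext x
  rcases x with i | k
  · rw [D.mate_inl, D'.mate_inl, h]
  · exact k.elim0

/-- The diagram without bottom points with the given strands. -/
def Diagram.ofArc {m : ℕ} (f : Fin m → Fin m) (h1 : ∀ i, f (f i) = i) (h2 : ∀ i, f i ≠ i)
    (h3 : ∀ i j, ¬ (i < j ∧ j < f i ∧ f i < f j)) : Diagram m 0 where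
  mate := Sum.map f id
  mate_mate := by rintro (i | k); exacts [congrArg _ (h1 i), k.elim0]
  mate_ne := by rintro (i | k); exacts [fun h => h2 i (Sum.inl_injective h), k.elim0]
  noncrossing := by rintro (i | k) (j | k'); exacts [h3 i j, k'.elim0, k.elim0, k.elim0]

/-- A diagram with at least one strand and no bottom points has a strand joining neighbours. -/
theorem Diagram.exists_arc_eq_succ {n : ℕ} (D : Diagram (n + 1) 0) :
    ∃ i : Fin (n + 1), (D.arc i : ℕ) = i + 1 := by
  -- Take a shortest strand, listed by its left end. If it did not join neighbours, the strand at `i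
  -- + 1` would be nested inside it and be shorter.
  obtain ⟨i, hi, hmin⟩ := Finset.exists_min_image
    (Finset.univ.filter fun i : Fin (n + 1) => i < D.arc i) (fun i => (D.arc i : ℕ) - i) (by
      rcases lt_or_gt_of_ne (D.arc_ne 0) with h | h
      · simp at h
      · exact ⟨0, by simpa using h⟩)
  simp only [Finset.mem_filter, Finset.mem_univ, true_and] at hi hmin
  refine ⟨i, ?_⟩
  by_contra hne
  have hi' : (i : ℕ) < D.arc i := hi
  have hb := (D.arc i).2
  obtain ⟨j, hj⟩ : ∃ j : Fin (n + 1), (j : ℕ) = i + 1 := ⟨⟨i + 1, by omega⟩, rfl⟩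
  have c1 := D.arc_noncrossing i j
  have c2 := D.arc_noncrossing (D.arc j) i
  have n1 := D.arc_ne j
  have n2 : D.arc j ≠ i := by
    intro h
    have := D.arc_arc j
    rw [h] at this
    omega
  have n3 : D.arc j ≠ D.arc i := by
    intro h
    have := congrArg D.arc h
    rw [D.arc_arc, D.arc_arc] at this
    omega
  have m := hmin j
  rw [D.arc_arc] at c2
  simp only [Fin.lt_def, Ne, Fin.ext_iff] at *
  omega

/-! ### Splicing strands -/

open Classical in
/-- Join `u` with `v`, and the former partners of `u` and `v` with each other. -/
noncomputable def splice {X : Type*} (u v : X) (f : X → X) (y : X) : X :=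
  if y = u then v else if y = v then u else if y = f u then f v else if y = f v then f u else f y

section Splice

variable {X : Type*} {f : X → X} {u v : X}

theorem splice_splice_apply (h1 : ∀ x, f (f x) = x) (h2 : ∀ x, f x ≠ x) (y : X) :
    splice u v f (splice u v f y) = y := by
  unfold splice
  grind

theorem splice_apply_ne (h1 : ∀ x, f (f x) = x) (h2 : ∀ x, f x ≠ x) (huv : u ≠ v) (y : X) :
    splice u v f y ≠ y := by
  unfold splice
  grind

theorem splice_apply_left : splice u v f u = v := by simp [splice]

theorem splice_eq_self (h1 : ∀ x, f (f x) = x) (h : f u = v) : splice u v f = f := by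
  funext y
  unfold splice
  grind

theorem splice_splice_comm (h1 : ∀ x, f (f x) = x) (h2 : ∀ x, f x ≠ x) {u' v' : X}
    (huv : u ≠ v) (huv' : u' ≠ v') (h11 : u ≠ u') (h12 : u ≠ v') (h21 : v ≠ u') (h22 : v ≠ v') :
    splice u v (splice u' v' f) = splice u' v' (splice u v f) := by
  funext y
  grind (splits := 40) [splice]

/-- Splicing at `u', v'` joins `u` to `v` either because they were already joined or because the
strands at `u` and `v` ended at `u'` and `v'`. The latter alternatives are symmetric in the two
pairs, which is what makes the loop factors of distant generators agree. -/
theorem splice_cond_comm (h1 : ∀ x, f (f x) = x) {u' v' : X}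
    (huv' : u' ≠ v') (h11 : u ≠ u') (h12 : u ≠ v') (h21 : v ≠ u') (h22 : v ≠ v') :
    (f u' ≠ v' ∧ splice u' v' f u = v) ↔
    (f u' ≠ v' ∧ f u = v) ∨ (f u ≠ v ∧ f u' ≠ v' ∧ f u = u' ∧ f v = v') ∨
      (f u ≠ v ∧ f u' ≠ v' ∧ f u = v' ∧ f v = u') := by
  unfold splice
  grind

theorem splice_splice_braid (h1 : ∀ x, f (f x) = x) {w : X}
    (huv : u ≠ v) (huw : u ≠ w) (h : f u = v) :
    splice u v (splice v w f) = f := by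
  funext y
  unfold splice
  grind

theorem splice_splice_braid' (h1 : ∀ x, f (f x) = x) (h2 : ∀ x, f x ≠ x) {w : X}
    (huv : u ≠ v) (huw : u ≠ w) (h : f v = w) :
    splice v w (splice u v f) = f := by
  funext y
  unfold splice
  grind

end Splice

theorem splice_noncrossing {m : ℕ} (D : Diagram m 0) {u v : Fin m} (huv : (v : ℕ) = u + 1)
    (i j : Fin m) : ¬ (i < j ∧ j < splice u v D.arc i ∧ splice u v D.arc i < splice u v D.arc j) := by
  have N : ∀ x y : Fin m, ¬ ((x : ℕ) < y ∧ (y : ℕ) < D.arc x ∧ (D.arc x : ℕ) < D.arc y) := D.arc_noncrossing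
  have A := D.arc_arc
  have B := D.arc_ne
  by_cases hi1 : i = u
  · simp only [splice, hi1, if_true, Fin.lt_def]; omega
  by_cases hi2 : i = v
  · simp only [splice, hi2, if_true, Fin.lt_def]; split_ifs <;> omega
  by_cases hj1 : j = u
  · simp only [splice, hj1, if_true, Fin.lt_def]; omega
  by_cases hj2 : j = v
  · simp only [splice, hj2, if_true, Fin.lt_def]; split_ifs <;> omega
  -- The two ends of a strand lie on the same side of any other strand. As `u` and `v` are adjacent,
  -- a strand avoiding both has them on one side, so their partners are on that side too, and the
  -- new strand joining the partners does not cross it.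
  have key : ∀ x y : Fin m, (x : ℕ) < D.arc x → y ≠ x → y ≠ D.arc x →
      ((x : ℕ) < y ∧ (y : ℕ) < D.arc x ↔ (x : ℕ) < D.arc y ∧ (D.arc y : ℕ) < D.arc x) := by
    intro x y h1 h2 h3
    have e1 : D.arc y ≠ x := fun h => h3 (by rw [← h, A])
    have e2 : D.arc y ≠ D.arc x := fun h => h2 (by rw [← A y, h, A])
    have n1 := N x y
    have n2 := N y x
    have n3 := N x (D.arc y)
    have n4 := N (D.arc y) x
    simp only [A, Ne, Fin.ext_iff] at *
    omega
  have inj : ∀ x y, D.arc x = y → x = D.arc y := fun x y h => by rw [← h, A]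
  by_cases hi : i = D.arc u ∨ i = D.arc v
  · by_cases hj : j = D.arc u ∨ j = D.arc v
    · unfold splice; grind
    have ku := key j u
    have kv := key j v
    have hu := mt (inj j u) (by tauto)
    have hv := mt (inj j v) (by tauto)
    simp only [splice, hi1, hi2, hj1, hj2, if_false, Fin.lt_def]
    simp only [Ne, Fin.ext_iff] at *
    split_ifs <;> omega
  · by_cases hj : j = D.arc u ∨ j = D.arc v
    · have ku := key i u
      have kv := key i v
      have hu := mt (inj i u) (by tauto)
      have hv := mt (inj i v) (by tauto)
      simp only [splice, hi1, hi2, hj1, hj2, if_false, Fin.lt_def]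
      simp only [Ne, Fin.ext_iff] at *
      split_ifs <;> omega
    · push Not at hi hj
      simp only [splice, hi1, hi2, hj1, hj2, hi.1, hi.2, hj.1, hj.2, if_false, Fin.lt_def]
      exact N i j

/-! ### The Temperley-Lieb generators acting on diagrams without bottom points -/

/-- Cut the strands at `i` and `i + 1`, join these two points with each other, and the remaining
ends with each other. -/
noncomputable def Diagram.capCup {n : ℕ} (D : Diagram (n + 2) 0) (i : Fin (n + 1)) :
    Diagram (n + 2) 0 :=
  Diagram.ofArc (splice i.castSucc i.succ D.arc)
    (splice_splice_apply D.arc_arc D.arc_ne)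
    (splice_apply_ne D.arc_arc D.arc_ne Fin.castSucc_lt_succ.ne)
    (splice_noncrossing D (by simp))

theorem Diagram.arc_capCup {n : ℕ} (D : Diagram (n + 2) 0) (i : Fin (n + 1)) :
    (D.capCup i).arc = splice i.castSucc i.succ D.arc := rfl

section Generators

variable {K : Type*} [Field K] (d : K) {n : ℕ}

open Classical in
/-- The factor acquired by a diagram under `capCup`. -/
noncomputable def capCupFactor (D : Diagram (n + 2) 0) (i : Fin (n + 1)) : K :=
  if D.arc i.castSucc = i.succ then d else 1

/-- The action of the `i`-th Temperley-Lieb generator on `Hom K (n + 2) 0`. -/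
noncomputable def generator (i : Fin (n + 1)) : Module.End K (Hom K (n + 2) 0) :=
  Finsupp.linearCombination K fun D => Finsupp.single (D.capCup i) (capCupFactor d D i)

theorem generator_single (i : Fin (n + 1)) (D : Diagram (n + 2) 0) (x : K) :
    generator d i (Finsupp.single D x) = Finsupp.single (D.capCup i) (x * capCupFactor d D i) := by
  simp [generator, Finsupp.linearCombination_single]

theorem capCup_eq_self {D : Diagram (n + 2) 0} {i : Fin (n + 1)}
    (h : D.arc i.castSucc = i.succ) : D.capCup i = D :=
  Diagram.arc_injective (splice_eq_self D.arc_arc h)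

theorem arc_capCup_castSucc (D : Diagram (n + 2) 0) (i : Fin (n + 1)) :
    (D.capCup i).arc i.castSucc = i.succ := splice_apply_left

theorem generator_single_of_arc_eq {D : Diagram (n + 2) 0} {i : Fin (n + 1)}
    (h : D.arc i.castSucc = i.succ) (x : K) :
    generator d i (Finsupp.single D x) = d • Finsupp.single D x := by
  rw [generator_single, capCup_eq_self h, capCupFactor, if_pos h, Finsupp.smul_single,
    smul_eq_mul, mul_comm]

theorem generator_mul_self (i : Fin (n + 1)) :
    generator d i * generator d i = d • generator d i := by
  refine Finsupp.lhom_ext fun D x => ?_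
  rw [Module.End.mul_apply, LinearMap.smul_apply, generator_single,
    generator_single_of_arc_eq d (arc_capCup_castSucc D i)]

theorem generator_braid {i j : Fin (n + 1)} (hij : (j : ℕ) = i + 1) :
    generator d j * generator d i * generator d j = generator d j := by
  refine Finsupp.lhom_ext fun D x => ?_
  rw [Module.End.mul_apply, Module.End.mul_apply, generator_single]
  set D' := D.capCup j
  have h : D'.arc j.castSucc = j.succ := arc_capCup_castSucc D j
  have e : i.succ = j.castSucc := Fin.ext (by simp [hij])
  have n1 : i.castSucc ≠ j.castSucc := by simp [Fin.ext_iff]; omega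
  have n2 : i.castSucc ≠ j.succ := by simp [Fin.ext_iff]; omega
  rw [generator_single, generator_single]
  -- In `D'` the point shared by the two generators is already joined to the other end of `j`, so
  -- neither of the two further moves closes a loop.
  have c1 : capCupFactor d D' i = 1 := by
    rw [capCupFactor, if_neg]
    rw [e]
    intro h1
    rw [← h1, D'.arc_arc] at h
    exact n2 h
  have c2 : capCupFactor d (D'.capCup i) j = 1 := by
    rw [capCupFactor, if_neg]
    rw [D'.arc_capCup, e]
    unfold splice
    simp only [n1.symm, if_true, if_false]
    exact n2
  have c3 : (D'.capCup i).capCup j = D' := by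
    apply Diagram.arc_injective
    rw [Diagram.arc_capCup, Diagram.arc_capCup, e]
    exact splice_splice_braid' D'.arc_arc D'.arc_ne n1 n2 h
  rw [c1, c2, c3, mul_one, mul_one]

theorem generator_commute {i j : Fin (n + 1)} (hij : (i : ℕ) + 1 < j) :
    Commute (generator d i) (generator d j) := by
  refine Finsupp.lhom_ext fun D x => ?_
  rw [Module.End.mul_apply, Module.End.mul_apply, generator_single, generator_single,
    generator_single, generator_single]
  have n0 : i.castSucc ≠ i.succ := Fin.castSucc_lt_succ.ne
  have n0' : j.castSucc ≠ j.succ := Fin.castSucc_lt_succ.ne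
  have n1 : i.castSucc ≠ j.castSucc := by simp [Fin.ext_iff]; omega
  have n2 : i.castSucc ≠ j.succ := by simp [Fin.ext_iff]; omega
  have n3 : i.succ ≠ j.castSucc := by simp [Fin.ext_iff]; omega
  have n4 : i.succ ≠ j.succ := by simp [Fin.ext_iff]; omega
  have h1 : (D.capCup j).capCup i = (D.capCup i).capCup j :=
    Diagram.arc_injective (splice_splice_comm D.arc_arc D.arc_ne n0 n0' n1 n2 n3 n4)
  have h2 : capCupFactor d D j * capCupFactor d (D.capCup j) i =
      capCupFactor d D i * capCupFactor d (D.capCup i) j := by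
    by_cases hi : D.arc i.castSucc = i.succ
    · by_cases hj : D.arc j.castSucc = j.succ
      · simp [capCupFactor, capCup_eq_self, hi, hj]
      · have := (splice_cond_comm D.arc_arc n0' n1 n2 n3 n4).2 (Or.inl ⟨hj, hi⟩)
        simp [capCupFactor, capCup_eq_self, hi, hj, Diagram.arc_capCup, this.2]
    · by_cases hj : D.arc j.castSucc = j.succ
      · have := (splice_cond_comm D.arc_arc n0 n1.symm n3.symm n2.symm n4.symm).2 (Or.inl ⟨hi, hj⟩)
        simp [capCupFactor, capCup_eq_self, hi, hj, Diagram.arc_capCup, this.2]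
      · have c1 := splice_cond_comm D.arc_arc n0' n1 n2 n3 n4
        have c2 := splice_cond_comm D.arc_arc n0 n1.symm n3.symm n2.symm n4.symm
        -- With no loop closed at the first move, one closes at the second exactly when the strands
        -- at the two pairs join them to each other, a symmetric condition.
        have : (splice j.castSucc j.succ D.arc i.castSucc = i.succ) ↔
            (splice i.castSucc i.succ D.arc j.castSucc = j.succ) := by
          have A := D.arc_arc
          grind
        simp only [capCupFactor, Diagram.arc_capCup, hi, hj, if_false, one_mul]
        exact if_congr this rfl rfl
  rw [h1, mul_assoc, mul_assoc, h2]

/-- If the quantum integers do not vanish, no non-zero element of `Hom K (n + 2) 0` is annihilated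
by all Temperley-Lieb generators. -/
theorem exists_generator_ne_zero (hq : ∀ k, quantumInt d (k + 1) ≠ 0)
    {x : Hom K (n + 2) 0} (hx : x ≠ 0) : ∃ i : Fin (n + 1), generator d i x ≠ 0 := by
  by_contra! H
  obtain ⟨p, hp, hspan⟩ := exists_jonesWenzl (A := Module.End K (Hom K (n + 2) 0)) hq
    -- The value `0` out of range is a filler: only indices below `L` occur in the hypotheses and
    -- conclusion.
    (L := n + 1) (e := fun i => if h : i < n + 1 then generator d ⟨i, h⟩ else 0)
    (fun i hi => by simpa [hi] using generator_mul_self d ⟨i, hi⟩)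
    (fun i hi => by
      have hi' : i < n + 1 := by omega
      simpa [hi', Nat.lt_of_succ_lt_succ hi] using
        generator_braid d (i := ⟨i, hi'⟩) (j := ⟨i + 1, hi⟩) rfl)
    (fun i j hij hj => by
      have hi' : i < n + 1 := by omega
      simpa only [hi', hj, dif_pos] using
        generator_commute d (i := ⟨i, hi'⟩) (j := ⟨j, hj⟩) hij)
  have hd : d ≠ 0 := by simpa [quantumInt] using hq 1
  -- Each diagram `D` joins some neighbours `k, k + 1`, so `d • D` is the image of `D` under the
  -- `k`-th generator and is killed by `p`; and `d = [2]` is invertible.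
  have hp0 : p = 0 := by
    refine Finsupp.lhom_ext fun D y => ?_
    obtain ⟨k, hk⟩ := D.exists_arc_eq_succ
    have hk' : (k : ℕ) < n + 1 := by omega
    have h := generator_single_of_arc_eq d (D := D) (i := ⟨k, hk'⟩) (Fin.ext hk) y
    have h2 := LinearMap.congr_fun (hp k hk') (Finsupp.single D y)
    simp only [hk', dif_pos, Module.End.mul_apply, h, map_smul, LinearMap.zero_apply] at h2 ⊢
    exact (smul_eq_zero.1 h2).resolve_left hd
  -- Now `1` lies in the left ideal generated by the generators, all of whose elements kill `x`.
  rw [hp0] at hspan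
  have : ∀ f ∈ Ideal.span ((fun i => if h : i < n + 1 then generator d ⟨i, h⟩ else 0) ''
      Set.Iio (n + 1)), f x = 0 := by
    intro f hf
    induction hf using Submodule.span_induction with
    | mem y hy =>
      obtain ⟨i, hi, rfl⟩ := hy
      simp only [dif_pos (Set.mem_Iio.1 hi), H]
    | zero => simp
    | add y z _ _ hy hz => rw [LinearMap.add_apply, hy, hz, add_zero]
    | smul a y _ hy => rw [smul_eq_mul, Module.End.mul_apply, hy, map_zero]
  exact hx (by simpa using this _ hspan)

end Generators

/-! ### Tracing curves in a juxtaposition. -/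

section Reachable

variable {l m n : ℕ} (a : Diagram l m) (b : Diagram m n)

theorem reachable_upperPt (x : Fin l ⊕ Fin m) :
    (juxtapose a b).Reachable (upperPt x) (upperPt (a.mate x)) :=
  (juxtapose_reachable_iff a b _ _).2
    (.single (Or.inl (upperStep_upperPt a x).symm))

theorem reachable_inr (x : Fin m ⊕ Fin n) :
    (juxtapose a b).Reachable (Sum.inr x) (Sum.inr (b.mate x)) :=
  (juxtapose_reachable_iff a b _ _).2 (.single (Or.inr rfl))

theorem reachable_arc (b : Diagram m 0) (y : Fin m) :
    (juxtapose a b).Reachable (Sum.inr (Sum.inl y)) (Sum.inr (Sum.inl (b.arc y))) := by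
  have := reachable_inr a b (Sum.inl y)
  rwa [b.mate_inl] at this

theorem loops_eq_zero (h : ∀ p, ∃ x, (juxtapose a b).Reachable (outerPt x) p) :
    loops a b = 0 := by
  rw [loops, Nat.card_eq_zero]
  left
  refine ⟨fun ⟨c, hc⟩ => ?_⟩
  induction c using SimpleGraph.ConnectedComponent.ind with
  | h p =>
    obtain ⟨x, hx⟩ := h p
    exact hc x ((SimpleGraph.ConnectedComponent.mem_supp_iff _ _).2
      (SimpleGraph.ConnectedComponent.eq.2 hx))

/-- A curve has only one other outer end, so exhibiting a path is enough to compute a strand of a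
composite. -/
theorem arc_comp_eq (b : Diagram m 0) {i j : Fin l} (hij : j ≠ i)
    (h : (juxtapose a b).Reachable (Sum.inl i) (Sum.inl j)) : (b.comp a).arc i = j := by
  have h1 : Sum.inl j = compMate a b (Sum.inl i) :=
    eq_compMate a b (by simpa using hij) h
  apply Sum.inl_injective (β := Fin 0)
  rw [h1, ← Diagram.mate_inl]
  rfl

end Reachable

/-! ### Composition with a cup -/

section Cup

variable {n : ℕ}

/-- The order embedding of `Fin n` into `Fin (n + 2)` that omits `i` and `i + 1`. -/
def skipTwo (i : Fin (n + 1)) (j : Fin n) : Fin (n + 2) :=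
  ⟨if (j : ℕ) < i then j else j + 2, by split_ifs <;> omega⟩

theorem exists_skipTwo_eq {i : Fin (n + 1)} {y : Fin (n + 2)} (h1 : y ≠ i.castSucc)
    (h2 : y ≠ i.succ) : ∃ j, skipTwo i j = y := by
  simp only [Ne, Fin.ext_iff, Fin.val_castSucc, Fin.val_succ] at h1 h2
  by_cases h : (y : ℕ) < i
  · exact ⟨⟨y, by omega⟩, Fin.ext (by simp [skipTwo, h])⟩
  · refine ⟨⟨y - 2, by omega⟩, Fin.ext ?_⟩
    simp only [skipTwo]
    split_ifs <;> omega

theorem skipTwo_ne_castSucc (i : Fin (n + 1)) (j : Fin n) : skipTwo i j ≠ i.castSucc := by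
  simp only [skipTwo, Ne, Fin.ext_iff, Fin.val_castSucc]
  split_ifs <;> omega

theorem skipTwo_ne_succ (i : Fin (n + 1)) (j : Fin n) : skipTwo i j ≠ i.succ := by
  simp only [skipTwo, Ne, Fin.ext_iff, Fin.val_succ]
  split_ifs <;> omega

/-- The diagram with `n` through strands and one cup joining the bottom points `i` and `i + 1`. -/
def Diagram.cup (i : Fin (n + 1)) : Diagram n (n + 2) where
  mate
    | Sum.inl j => Sum.inr (skipTwo i j)
    | Sum.inr y =>
      if h : (y : ℕ) < i then Sum.inl ⟨y, by omega⟩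
      else if h1 : (y : ℕ) = i then Sum.inr i.succ
      else if h2 : (y : ℕ) = i + 1 then Sum.inr i.castSucc
      else Sum.inl ⟨y - 2, by omega⟩
  mate_mate := by
    rintro (j | y)
    · simp only [skipTwo]
      split_ifs <;> first | omega | (congr 1)
    · dsimp only
      split_ifs with h h1 h2
      · simp [skipTwo, h]
      · simp [Fin.ext_iff, h1]
      · simp [Fin.ext_iff, h2]
      · simp only [skipTwo, Sum.inr.injEq, Fin.ext_iff]
        split_ifs <;> omega
  mate_ne := by
    rintro (j | y)
    · simp
    · dsimp only
      split_ifs <;> simp [Fin.ext_iff] <;> omega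
  noncrossing := by
    rintro (j | y) (k | z) <;> dsimp only <;> (try split_ifs) <;>
      simp only [pos, skipTwo, Fin.val_rev, Fin.val_succ, Fin.val_castSucc] <;>
      (try split_ifs) <;> omega

theorem Diagram.cup_mate_castSucc (i : Fin (n + 1)) :
    (Diagram.cup i).mate (Sum.inr i.castSucc) = Sum.inr i.succ := by
  simp [Diagram.cup]

variable (D : Diagram (n + 2) 0) (i : Fin (n + 1))

theorem reachable_skipTwo (j : Fin n) :
    (juxtapose (Diagram.cup i) D).Reachable (Sum.inl j) (Sum.inr (Sum.inl (skipTwo i j))) :=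
  reachable_upperPt (Diagram.cup i) D (Sum.inl j)

theorem reachable_castSucc_succ :
    (juxtapose (Diagram.cup i) D).Reachable (Sum.inr (Sum.inl i.castSucc))
      (Sum.inr (Sum.inl i.succ)) := by
  have := reachable_upperPt (Diagram.cup i) D (Sum.inr i.castSucc)
  rwa [Diagram.cup_mate_castSucc] at this

theorem reachable_splice (y : Fin (n + 2)) :
    (juxtapose (Diagram.cup i) D).Reachable (Sum.inr (Sum.inl y))
      (Sum.inr (Sum.inl (splice i.castSucc i.succ D.arc y))) := by
  have h := reachable_castSucc_succ D i
  have hu := reachable_arc (Diagram.cup i) D i.castSucc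
  have hv := reachable_arc (Diagram.cup i) D i.succ
  unfold splice
  split_ifs with h1 h2 h3 h4
  · rw [h1]; exact h
  · rw [h2]; exact h.symm
  · rw [h3]; exact hu.symm.trans (h.trans hv)
  · rw [h4]; exact hv.symm.trans (h.symm.trans hu)
  · exact reachable_arc _ D y

/-- Composing with the cup and applying `capCup` splice the same strands; `capCup` merely keeps the
extra strand joining `i` and `i + 1`. -/
theorem skipTwo_arc_comp_cup (j : Fin n) :
    skipTwo i ((D.comp (Diagram.cup i)).arc j) = (D.capCup i).arc (skipTwo i j) := by
  have hA := (D.capCup i).arc_arc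
  have hs := arc_capCup_castSucc D i
  obtain ⟨k, hk⟩ := exists_skipTwo_eq (i := i) (y := (D.capCup i).arc (skipTwo i j))
    (fun h => skipTwo_ne_succ i j (by rw [← hA (skipTwo i j), h, hs]))
    (fun h => skipTwo_ne_castSucc i j (by rw [← hA (skipTwo i j), h, ← hs, hA]))
  rw [← hk]
  congr 1
  apply arc_comp_eq
  · rintro rfl
    exact (D.capCup i).arc_ne _ hk.symm
  · refine (reachable_skipTwo D i j).trans ((reachable_splice D i _).trans ?_)
    rw [← D.arc_capCup, ← hk]
    exact (reachable_skipTwo D i k).symm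

/-- `capCup` is recovered from the composite by reinserting the strand at `i, i + 1`. This makes the
generator factor through composition with the cup. -/
theorem capCup_eq_of_comp_cup_eq {D D' : Diagram (n + 2) 0} {i : Fin (n + 1)}
    (h : D.comp (Diagram.cup i) = D'.comp (Diagram.cup i)) : D.capCup i = D'.capCup i := by
  apply Diagram.arc_injective
  funext y
  by_cases h1 : y = i.castSucc
  · rw [h1, arc_capCup_castSucc, arc_capCup_castSucc]
  by_cases h2 : y = i.succ
  · rw [h2]
    nth_rw 1 [← arc_capCup_castSucc D i]
    rw [← arc_capCup_castSucc D' i, Diagram.arc_arc, Diagram.arc_arc]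
  obtain ⟨j, rfl⟩ := exists_skipTwo_eq h1 h2
  rw [← skipTwo_arc_comp_cup, ← skipTwo_arc_comp_cup, h]

theorem loops_cup_of_arc_ne (h : D.arc i.castSucc ≠ i.succ) : loops (Diagram.cup i) D = 0 := by
  have hA := D.arc_arc
  have hs : ∀ j, ∃ x : Fin n ⊕ Fin 0, (juxtapose (Diagram.cup i) D).Reachable (outerPt x)
      (Sum.inr (Sum.inl (skipTwo i j))) := fun j => ⟨Sum.inl j, reachable_skipTwo D i j⟩
  have hu : ∃ x : Fin n ⊕ Fin 0, (juxtapose (Diagram.cup i) D).Reachable (outerPt x)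
      (Sum.inr (Sum.inl i.castSucc)) := by
    obtain ⟨j, hj⟩ := exists_skipTwo_eq (D.arc_ne i.castSucc) h
    obtain ⟨x, hx⟩ := hs j
    rw [hj] at hx
    exact ⟨x, hx.trans (reachable_arc _ D _).symm⟩
  apply loops_eq_zero
  rintro (j | y | z)
  · exact ⟨Sum.inl j, .refl _⟩
  · by_cases h1 : y = i.castSucc
    · rw [h1]; exact hu
    by_cases h2 : y = i.succ
    · obtain ⟨x, hx⟩ := hu
      rw [h2]; exact ⟨x, hx.trans (reachable_castSucc_succ D i)⟩
    obtain ⟨j, rfl⟩ := exists_skipTwo_eq h1 h2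
    exact hs j
  · exact z.elim0

theorem loops_cup_of_arc_eq (h : D.arc i.castSucc = i.succ) : loops (Diagram.cup i) D = 1 := by
  have h' : D.arc i.succ = i.castSucc := by rw [← h, D.arc_arc]
  have hmate : (Diagram.cup i).mate (Sum.inr i.succ) = Sum.inr i.castSucc := by
    rw [← Diagram.cup_mate_castSucc, Diagram.mate_mate]
  rw [loops, Nat.card_eq_one_iff_unique]
  constructor
  · have key : ∀ c : (juxtapose (Diagram.cup i) D).ConnectedComponent,
        (∀ x : Fin n ⊕ Fin 0, outerPt x ∉ c.supp) →
        c = (juxtapose (Diagram.cup i) D).connectedComponentMk (Sum.inr (Sum.inl i.castSucc)) := by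
      intro c hc
      induction c using SimpleGraph.ConnectedComponent.ind with
      | h p =>
        have hc' : ∀ j : Fin n, ¬ (juxtapose (Diagram.cup i) D).Reachable (Sum.inl j) p :=
          fun j hj => hc (Sum.inl j) ((SimpleGraph.ConnectedComponent.mem_supp_iff _ _).2
            (SimpleGraph.ConnectedComponent.eq.2 hj))
        rw [SimpleGraph.ConnectedComponent.eq]
        rcases p with j | y | z
        · exact absurd (.refl _) (hc' j)
        · by_cases h1 : y = i.castSucc
          · rw [h1]
          by_cases h2 : y = i.succ
          · rw [h2]; exact (reachable_castSucc_succ D i).symm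
          obtain ⟨j, rfl⟩ := exists_skipTwo_eq h1 h2
          exact absurd (reachable_skipTwo D i j) (hc' j)
        · exact z.elim0
    exact ⟨fun c c' => Subtype.ext ((key _ c.2).trans (key _ c'.2).symm)⟩
  · refine ⟨(juxtapose (Diagram.cup i) D).connectedComponentMk (Sum.inr (Sum.inl i.castSucc)), ?_⟩
    intro x hx
    rw [SimpleGraph.ConnectedComponent.mem_supp_iff, SimpleGraph.ConnectedComponent.eq] at hx
    have hx' := (juxtapose_reachable_iff _ _ _ _).1 hx.symm
    -- The two points `i` and `i + 1` of the common edge are closed under both steps, so their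
    -- component never reaches the outer boundary.
    have : outerPt x = (Sum.inr (Sum.inl i.castSucc) : Fin n ⊕ (Fin (n + 2) ⊕ Fin 0)) ∨
        outerPt x = (Sum.inr (Sum.inl i.succ) : Fin n ⊕ (Fin (n + 2) ⊕ Fin 0)) := by
      generalize (outerPt x : Fin n ⊕ (Fin (n + 2) ⊕ Fin 0)) = p at hx'
      induction hx' with
      | refl => exact Or.inl rfl
      | tail _ hstep ih =>
        rcases ih with rfl | rfl <;> rcases hstep with rfl | rfl <;>
          simp [upperStep, lowerStep, Diagram.cup_mate_castSucc, hmate, Diagram.mate_inl, h, h',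
            upperPt]
    rcases x with x | x
    · simp [outerPt] at this
    · exact x.elim0

theorem pow_loops_cup {K : Type*} [Field K] (d : K) :
    d ^ loops (Diagram.cup i) D = capCupFactor d D i := by
  by_cases h : D.arc i.castSucc = i.succ
  · rw [loops_cup_of_arc_eq D i h, capCupFactor, if_pos h, pow_one]
  · rw [loops_cup_of_arc_ne D i h, capCupFactor, if_neg h, pow_zero]

end Cup

/-! ### Generators factor through cups. -/

theorem comp_single {K : Type*} [Field K] (d : K) {l m n : ℕ} (g : Hom K m n) (a : Diagram l m) :
    comp d g (Finsupp.single a 1) =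
      g.sum fun b y => Finsupp.single (b.comp a) (y * d ^ loops a b) := by
  unfold comp
  refine Finsupp.sum_congr fun b _ => ?_
  rw [Finsupp.sum_single_index (by simp), mul_one]

/-- The generator is composition with the cup followed by a linear map, since both the diagrams and
the powers of `d` match. -/
theorem comp_cup_ne_zero {K : Type*} [Field K] {d : K} {n : ℕ} {x : Hom K (n + 2) 0}
    {i : Fin (n + 1)} (h : generator d i x ≠ 0) :
    comp d x (Finsupp.single (Diagram.cup i) 1) ≠ 0 := by
  intro h0
  have hx : x ≠ 0 := fun hx => h (by rw [hx, map_zero])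
  obtain ⟨D₀, -⟩ := Finsupp.support_nonempty_iff.2 hx
  have hfac : Function.FactorsThrough (fun D : Diagram (n + 2) 0 => D.capCup i)
      (fun D => D.comp (Diagram.cup i)) := fun D D' => capCup_eq_of_comp_cup_eq
  apply h
  -- `D₀` is only a default for diagrams not of the form `D.comp (Diagram.cup i)`; none occurs in
  -- the sum.
  have : generator d i x = Finsupp.mapDomain
      (Function.extend (fun D : Diagram (n + 2) 0 => D.comp (Diagram.cup i))
        (fun D => D.capCup i) fun _ => D₀)
      (comp d x (Finsupp.single (Diagram.cup i) 1)) := by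
    rw [comp_single, Finsupp.sum, Finsupp.mapDomain_finsetSum, generator,
      Finsupp.linearCombination_apply, Finsupp.sum]
    refine Finset.sum_congr rfl fun D _ => ?_
    rw [Finsupp.mapDomain_single, hfac.extend_apply, Finsupp.smul_single, smul_eq_mul,
      pow_loops_cup]
  rw [this, h0, Finsupp.mapDomain_zero]

/-! ### Bending the bottom points of a diagram to the top -/

/-- The identity diagram. -/
def Diagram.one (n : ℕ) : Diagram n n where
  mate := Sum.swap
  mate_mate := by rintro (i | i) <;> rfl
  mate_ne := by rintro (i | i) <;> simp
  noncrossing := by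
    rintro (i | i) (j | j) <;> simp only [pos, Sum.swap_inl, Sum.swap_inr, Fin.val_rev] <;> omega

/-- The diagram of `n` nested caps. -/
def Diagram.caps (n : ℕ) : Diagram (n + n) 0 :=
  Diagram.ofArc Fin.rev Fin.rev_rev
    (fun i h => by simp only [Fin.ext_iff, Fin.val_rev] at h; omega)
    (fun i j => by simp only [Fin.lt_def, Fin.val_rev]; omega)

theorem Diagram.arc_caps (n : ℕ) (i : Fin (n + n)) : (Diagram.caps n).arc i = i.rev := rfl

section Bend

variable {m n : ℕ}

/-- The diagram obtained by bending the bottom points to the top. -/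
noncomputable def Diagram.bend (D : Diagram m n) : Diagram (m + n) 0 :=
  (Diagram.caps n).comp (D.tensor (Diagram.one n))

/-- The points of a diagram, in the order of the boundary walk. -/
def boundaryPt : Fin m ⊕ Fin n → Fin (m + n) :=
  fun x => ⟨pos x, pos_lt x⟩

theorem boundaryPt_injective : Function.Injective (boundaryPt : Fin m ⊕ Fin n → Fin (m + n)) :=
  fun _ _ h => pos_injective (Fin.ext_iff.1 h)

/-- The points of the left factor in the juxtaposition defining `Diagram.bend`. -/
def leftPt (x : Fin m ⊕ Fin n) : Fin (m + n) ⊕ (Fin (n + n) ⊕ Fin 0) :=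
  upperPt ((tensorPts m n n n).symm (Sum.inl x))

variable (D : Diagram m n)

theorem reachable_leftPt_mate (x : Fin m ⊕ Fin n) :
    (juxtapose (D.tensor (Diagram.one n)) (Diagram.caps n)).Reachable (leftPt x)
      (leftPt (D.mate x)) := by
  have := reachable_upperPt (D.tensor (Diagram.one n)) (Diagram.caps n)
    ((tensorPts m n n n).symm (Sum.inl x))
  simpa only [Diagram.tensor, Equiv.apply_symm_apply, Sum.map_inl, leftPt] using this

theorem reachable_natAdd (k : Fin n) :
    (juxtapose (D.tensor (Diagram.one n)) (Diagram.caps n)).Reachable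
      (Sum.inl (Fin.natAdd m k)) (Sum.inr (Sum.inl (Fin.natAdd n k))) := by
  have := reachable_upperPt (D.tensor (Diagram.one n)) (Diagram.caps n)
    ((tensorPts m n n n).symm (Sum.inr (Sum.inl k)))
  simpa [Diagram.tensor, Diagram.one, tensorPts, upperPt] using this

/-- A bottom point `j` runs through a cap, which reverses the order, and then up an identity strand
to the top point `m + j.rev`. This is exactly its position `pos` on the boundary walk. -/
theorem reachable_boundaryPt (x : Fin m ⊕ Fin n) :
    (juxtapose (D.tensor (Diagram.one n)) (Diagram.caps n)).Reachable
      (Sum.inl (boundaryPt x)) (leftPt x) := by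
  rcases x with i | j
  · exact .refl _
  · have h := (reachable_natAdd D j.rev).trans (reachable_arc _ _ _)
    have e : (Diagram.caps n).arc (Fin.natAdd n j.rev) = Fin.castAdd n j := by
      rw [Diagram.arc_caps]
      ext
      simp only [Fin.val_rev, Fin.val_natAdd, Fin.val_castAdd]
      omega
    rw [e] at h
    exact h

theorem arc_bend (x : Fin m ⊕ Fin n) : D.bend.arc (boundaryPt x) = boundaryPt (D.mate x) :=
  arc_comp_eq _ _ (fun h => D.mate_ne x (boundaryPt_injective h))
    ((reachable_boundaryPt D x).trans ((reachable_leftPt_mate D x).trans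
      (reachable_boundaryPt D _).symm))

theorem bend_injective : Function.Injective (Diagram.bend : Diagram m n → Diagram (m + n) 0) := by
  intro D D' h
  ext1
  funext x
  apply boundaryPt_injective
  rw [← arc_bend, ← arc_bend, h]

/-- Every point of the common edge is connected to the top edge: the right half by identity strands,
the left half by a cap followed by one. -/
theorem loops_bend : loops (D.tensor (Diagram.one n)) (Diagram.caps n) = 0 := by
  apply loops_eq_zero
  rintro (i | y | z)
  · exact ⟨Sum.inl i, .refl _⟩
  · induction y using Fin.addCases with
    | left j => exact ⟨Sum.inl (boundaryPt (Sum.inr j)), reachable_boundaryPt D (Sum.inr j)⟩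
    | right k => exact ⟨Sum.inl (Fin.natAdd m k), reachable_natAdd D k⟩
  · exact z.elim0

end Bend

theorem tensor_single_one {K : Type*} [Field K] {m n m' n' : ℕ} (f : Hom K m n)
    (b : Diagram m' n') :
    tensor f (Finsupp.single b 1) = Finsupp.mapDomain (fun a => a.tensor b) f := by
  unfold tensor Finsupp.mapDomain
  refine Finsupp.sum_congr fun a _ => ?_
  rw [Finsupp.sum_single_index (by simp), mul_one]

theorem single_comp {K : Type*} [Field K] (d : K) {l m n : ℕ} (b : Diagram m n) (f : Hom K l m) :
    comp d (Finsupp.single b 1) f =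
      f.sum fun a x => Finsupp.single (b.comp a) (x * d ^ loops a b) := by
  unfold comp
  rw [Finsupp.sum_single_index (by simp)]
  simp only [one_mul]

theorem comp_caps_tensor_one {K : Type*} [Field K] (d : K) {m n : ℕ} (f : Hom K m n) :
    comp d (Finsupp.single (Diagram.caps n) 1) (tensor f (Finsupp.single (Diagram.one n) 1)) =
      Finsupp.mapDomain Diagram.bend f := by
  rw [tensor_single_one, single_comp, Finsupp.sum_mapDomain_index (by simp)
    (by intros; rw [add_mul, Finsupp.single_add])]
  simp only [loops_bend, pow_zero, mul_one]
  rfl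

/-! ### Ideals -/

namespace TensorIdeal

variable {K : Type*} [Field K] {d : K} (J : TensorIdeal K d)

theorem exists_mem_hom_zero_right (hJ : J.IsNonzero) :
    ∃ (n : ℕ) (f : Hom K n 0), f ∈ J.carrier n 0 ∧ f ≠ 0 := by
  obtain ⟨m, n, f, hf, hf0⟩ := hJ
  refine ⟨m + n, Finsupp.mapDomain Diagram.bend f, ?_, ?_⟩
  · rw [← comp_caps_tensor_one d]
    exact J.comp_left _ _ (J.tensor_right _ _ hf)
  · rw [← Finsupp.mapDomain_zero (f := Diagram.bend)]
    exact fun h => hf0 (Finsupp.mapDomain_injective bend_injective h)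

theorem exists_mem_hom_zero_zero (hq : ∀ k, quantumInt d (k + 1) ≠ 0) (n : ℕ) (f : Hom K n 0)
    (hf : f ∈ J.carrier n 0) (hf0 : f ≠ 0) : ∃ g : Hom K 0 0, g ∈ J.carrier 0 0 ∧ g ≠ 0 := by
  induction n using Nat.twoStepInduction with
  | zero => exact ⟨f, hf, hf0⟩
  | one =>
    obtain ⟨D, -⟩ := Finsupp.support_nonempty_iff.2 hf0
    -- `Hom 1 0` is zero: a single point has no partner.
    exact absurd (Subsingleton.elim _ _) (D.arc_ne 0)
  | more n ih _ =>
    obtain ⟨i, hi⟩ := exists_generator_ne_zero d hq hf0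
    exact ih _ (J.comp_right _ _ hf) (comp_cup_ne_zero hi)

/-- The unit stands on the right because `m + 0` is `m` by definition, so no transport between Hom
spaces is needed. -/
theorem tensor_one_zero {m n : ℕ} (f : Hom K m n) :
    tensor f (Finsupp.single (Diagram.one 0) 1) = f := by
  have : ∀ a : Diagram m n, a.tensor (Diagram.one 0) = a := by
    intro a
    have hp : ∀ x : Fin m ⊕ Fin n, (tensorPts m n 0 0).symm (Sum.inl x) = x := by
      rintro (i | j) <;> rfl
    ext1
    funext x
    obtain ⟨y, rfl⟩ := (tensorPts m n 0 0).symm.surjective x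
    rcases y with y | y | y
    · simp only [Diagram.tensor, Equiv.apply_symm_apply, Sum.map_inl]
      exact (hp _).trans (congrArg _ (hp y).symm)
    · exact y.elim0
    · exact y.elim0
  rw [tensor_single_one]
  simp only [this]
  exact Finsupp.mapDomain_id

/-- If the quantum integers do not vanish, a non-zero ideal contains all morphisms. -/
theorem not_isProper (hq : ∀ k, quantumInt d (k + 1) ≠ 0) (hJ : J.IsNonzero) : ¬ J.IsProper := by
  rintro ⟨m, n, f, hf⟩
  obtain ⟨k, g, hg, hg0⟩ := J.exists_mem_hom_zero_right hJ
  obtain ⟨g, hg, hg0⟩ := J.exists_mem_hom_zero_zero hq k g hg hg0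
  have hsub : ∀ D : Diagram 0 0, D = Diagram.one 0 := fun D => by
    ext1; funext x; rcases x with x | x <;> exact x.elim0
  have hg1 : g = Finsupp.single (Diagram.one 0) (g (Diagram.one 0)) := by
    ext D; rw [hsub D, Finsupp.single_eq_same]
  have hx : g (Diagram.one 0) ≠ 0 := fun h => hg0 (by rw [hg1, h, Finsupp.single_zero])
  -- `Hom 0 0` is spanned by the empty diagram, so a non-zero element can be rescaled to the tensor
  -- unit.
  have h1 : Finsupp.single (Diagram.one 0) 1 ∈ J.carrier 0 0 := by
    have := (J.carrier 0 0).smul_mem (g (Diagram.one 0))⁻¹ hg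
    rwa [hg1, Finsupp.smul_single, Finsupp.single_eq_same, smul_eq_mul, inv_mul_cancel₀ hx] at this
  have := J.tensor_left f _ h1
  rw [tensor_one_zero] at this
  exact hf this

end TensorIdeal

end TemperleyLieb

/-! ### The generic and the specialised loop parameter. -/

theorem corollary3p2 :
    (¬ ∃ J : TemperleyLieb.TensorIdeal (RatFunc ℂ) (RatFunc.X + RatFunc.X⁻¹),
        J.IsNonzero ∧ J.IsProper) ∧
    (∀ τ : ℂ, τ ≠ 0 → ¬ TemperleyLieb.IsProperRootOfUnity τ →
      ¬ ∃ J : TemperleyLieb.TensorIdeal ℂ (τ + τ⁻¹), J.IsNonzero ∧ J.IsProper) := by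
  constructor
  · rintro ⟨J, h1, h2⟩
    have : CharZero (RatFunc ℂ) := charZero_of_injective_algebraMap (algebraMap ℂ _).injective
    refine J.not_isProper (TemperleyLieb.quantumInt_ne_zero RatFunc.X_ne_zero ?_) h1 h2
    intro k hk h
    -- The variable is not a root of unity: `X ^ k = 1` would already hold among polynomials,
    -- against degrees.
    rw [← RatFunc.algebraMap_X, ← map_pow, map_eq_one_iff _ (RatFunc.algebraMap_injective ℂ)] at h
    have := congrArg Polynomial.natDegree h
    rw [Polynomial.natDegree_X_pow, Polynomial.natDegree_one] at this
    omega
  · rintro τ hτ hr ⟨J, h1, h2⟩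
    refine J.not_isProper (TemperleyLieb.quantumInt_ne_zero hτ ?_) h1 h2
    intro k hk h
    by_contra! hne
    exact hr ⟨⟨k, hk, h⟩, hne⟩
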